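/- Let $d\ge 4$ be even, let $V\in M_d(\mathbb C)$ be a skew-symmetric unitary matrix ($V^*V=I_d$, $V^\top=-V$; for example $V=\Omega_d=\begin{pmatrix}0&I_{d/2}\\-I_{d/2}&0\end{pmatrix}$), let $1\le k\le \frac d2-1$, and let $$\mathcal L_k^{\rm BH}(Z)=\frac{1}{kd-k-1}\bigl(k\,\mathrm{Tr}(Z)I_d-Z-kVZ^\top V^*\bigr),\qquad Z\in M_d(\mathbb C),$$ be the $k$-Breuer–Hall map. All maps below are linear maps $M_d(\mathbb C)\to M_d(\mathbb C)$. Such a map $\mathcal L$ is $m$-positive if $\mathrm{id}_m\otimes\mathcal L$ preserves positive semidefiniteness; it is completely positive if it is $m$-positive for all $m\ge1$; with $\top(Z)=Z^\top$, it is decomposable if $\mathcal L=\mathcal L_1+\mathcal L_2$ with $\mathcal L_1$ and $\top\circ\mathcal L_2$ completely positive, and indecomposable otherwise. Let $C_{\mathcal L}=\frac1d\sum_{i,j=1}^d|i\rangle\langle j|\otimes\mathcal L(|i\rangle\langle j|)$, and let $\mathcal{PPT}$ be the set of positive semidefinite $\rho\in M_d(\mathbb C)\otimes M_d(\mathbb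 C)$ of trace one such that $(\mathrm{id}_d\otimes\top)(\rho)$ is positive semidefinite. Then: 1. $\mathcal L_k^{\rm BH}$ is an optimal $k$-positive indecomposable map. That is, it is $k$-positive, not $(k+1)$-positive and indecomposable, and whenever $\mathcal L'$ is a $k$-positive indecomposable map with $$\{\rho\in\mathcal{PPT}:\mathrm{Tr}(\rho\, C_{\mathcal L_k^{\rm BH}})<0\}\subseteq\{\rho\in\mathcal{PPT}:\mathrm{Tr}(\rho\, C_{\mathcal L'})<0\},$$ then $\mathcal L'=c\,\mathcal L_k^{\rm BH}$ for some $c>0$. Moreover, there is no nonzero decomposable map $\mathcal L''$ such that $\mathcal L_k^{\rm BH}-\mathcal L''$ is $k$-positive. 2. $\mathcal L_k^{\rm BH}$ cannot be written as $\mathcal L'+\top\circ\mathcal L''$ with $(k+1)$-positive linear maps $\mathcal L'$ and $\mathcal L''$. (For $k=1$ this says that the Breuer–Hall map is atomic.) -/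

import Mathlib

open scoped Matrix Kronecker ComplexOrder

namespace BreuerHall

/-- The algebra `M_d(ℂ)`. -/
abbrev Mat (d : ℕ) : Type := Matrix (Fin d) (Fin d) ℂ

/-- Matrices in `M_m(ℂ) ⊗ M_d(ℂ)`, written in block form. -/
abbrev BiMat (m d : ℕ) : Type := Matrix (Fin m × Fin d) (Fin m × Fin d) ℂ

/-- Linear maps `M_d(ℂ) → M_d(ℂ)`. -/
abbrev MatMap (d : ℕ) : Type := Mat d →ₗ[ℂ] Mat d

/-- The ampliation `id_m ⊗ L`, applying `L` to each of the `m × m` blocks. -/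
def ampliation {d : ℕ} (m : ℕ) (L : MatMap d) (X : BiMat m d) : BiMat m d :=
  Matrix.of fun p q => L (Matrix.of fun a b => X (p.1, a) (q.1, b)) p.2 q.2

/-- `L` is `m`-positive: `id_m ⊗ L` maps positive semidefinite matrices to positive semidefinite
matrices. -/
def IsKPositive {d : ℕ} (m : ℕ) (L : MatMap d) : Prop :=
  ∀ X : BiMat m d, X.PosSemidef → (ampliation m L X).PosSemidef

/-- The transposition map `⊤ : Z ↦ Zᵀ`. -/
def transposeMap (d : ℕ) : MatMap d where
  toFun Z := Zᵀ
  map_add' := Matrix.transpose_add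
  map_smul' := Matrix.transpose_smul

/-- Completely positive maps. -/
def IsCP {d : ℕ} (L : MatMap d) : Prop := ∀ m : ℕ, 1 ≤ m → IsKPositive m L

/-- Completely copositive maps. -/
def IsCoCP {d : ℕ} (L : MatMap d) : Prop := IsCP (transposeMap d ∘ₗ L)

/-- Decomposable maps: sums of a completely positive and a completely copositive map. -/
def IsDecomposable {d : ℕ} (L : MatMap d) : Prop :=
  ∃ L₁ L₂ : MatMap d, IsCP L₁ ∧ IsCoCP L₂ ∧ L = L₁ + L₂

/-- The normalized Choi matrix `C_L = (1/d) ∑_{i,j} |i⟩⟨j| ⊗ L(|i⟩⟨j|)`. -/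
noncomputable def choi {d : ℕ} (L : MatMap d) : BiMat d d :=
  (d : ℂ)⁻¹ • ∑ i : Fin d, ∑ j : Fin d, Matrix.single i j (1 : ℂ) ⊗ₖ L (Matrix.single i j 1)

/-- The partial transpose `(id ⊗ ⊤)(ρ)` on the second tensor factor. -/
def partialTranspose {d : ℕ} (ρ : BiMat d d) : BiMat d d := ampliation d (transposeMap d) ρ

/-- PPT states: quantum states with positive semidefinite partial transpose. -/
structure IsPPTState {d : ℕ} (ρ : BiMat d d) : Prop where
  posSemidef : ρ.PosSemidef
  trace_eq_one : ρ.trace = 1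
  ppt : (partialTranspose ρ).PosSemidef

/-- The set of PPT states `ρ` detected by `L`, i.e. with `Tr(ρ C_L) < 0`. -/
def detectedPPT {d : ℕ} (L : MatMap d) : Set (BiMat d d) :=
  {ρ | IsPPTState ρ ∧ (ρ * choi L).trace < 0}

/-- `L` is an optimal `k`-positive indecomposable map: it is `k`-positive, not `(k+1)`-positive,
indecomposable, and every `k`-positive indecomposable map that detects at least the PPT states
detected by `L` is a positive multiple of `L`. -/
structure IsOptimalKPositiveIndecomposable {d : ℕ} (k : ℕ) (L : MatMap d) : Prop where
  kPositive : IsKPositive k L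
  not_succ_kPositive : ¬ IsKPositive (k + 1) L
  indecomposable : ¬ IsDecomposable L
  optimal : ∀ L' : MatMap d, IsKPositive k L' → ¬ IsDecomposable L' →
    detectedPPT L ⊆ detectedPPT L' → ∃ c : ℝ, 0 < c ∧ L' = (c : ℂ) • L

/-- The `k`-Breuer–Hall map
`Z ↦ (k Tr(Z) I − Z − k V Zᵀ V*) / (k d − k − 1)` associated with a matrix `V`. -/
noncomputable def breuerHallMap {d : ℕ} (k : ℕ) (V : Mat d) : MatMap d where
  toFun Z := ((k : ℂ) * d - k - 1)⁻¹ •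
    (((k : ℂ) * Z.trace) • (1 : Mat d) - Z - (k : ℂ) • (V * Zᵀ * Vᴴ))
  map_add' X Y := by
    simp only [Matrix.trace_add, Matrix.transpose_add, Matrix.add_mul, mul_add,
      add_smul, smul_add, smul_sub]
    abel
  map_smul' c X := by
    simp only [Matrix.trace_smul, Matrix.transpose_smul, Matrix.mul_smul, Matrix.smul_mul,
      smul_eq_mul, RingHom.id_apply]
    module

end BreuerHall

/-! Everything is read off the Hermitian form `choiForm L T = ⟨vec T, C_L vec T⟩` of the Choi
matrix: `L` is m-positive iff this form is nonnegative on matrices of rank at most m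
(`isKPositive_iff`).

For the Breuer–Hall map put N = V*T and K = N - Nᵀ. Up to the positive normalization the form is
(k/2)‖K‖² - |Tr T|², while Tr(VK) = 2 Tr T and rank K ≤ 2k when rank T ≤ k. Hence k-positivity
follows from |Tr(VK)|² ≤ rank(K) ‖K‖² (`norm_trace_mul_sq_le`).

Two families of zeros decide the rest. The product vectors T = (Vx)xᵀ have N symmetric and zero
trace; after partial transposition they span everything. The projection onto an isotropic
n-dimensional subspace has form value proportional to kn - n²: zero for n = k, negative for n = k +
1, and the rank-k ones span M_d. A mixture of both families is a state (up to scaling) of Schmidt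
number at most k, killed by the witness and interior to the PPT cone (`exists_interior_ppt`).

At such an interior point ρ, a decomposable L'' that can be subtracted is a functional nonnegative
nearby and nonpositive at ρ, hence zero. For optimality, perturbing ρ in each Hermitian direction
turns inclusion of detected PPT states into inclusion of open half-spaces, which forces
proportionality.

For part 2, L'' vanishes on the partially transposed product zeros; 2-positivity puts these in the
kernel of its Choi matrix, so L'' = 0 and the Breuer–Hall map would be (k+1)-positive.
Indecomposability is a special case. -/

namespace BreuerHall

open Matrix

/-! ### Positive semidefinite matrices -/

section Matrices

variable {n m : Type*} [Fintype n] [Fintype m]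

lemma isHermitian_of_forall_nonneg {M : Matrix n n ℂ} (h : ∀ x, 0 ≤ star x ⬝ᵥ M *ᵥ x) :
    M.IsHermitian := by
  classical
  rw [← isSymmetric_toEuclideanLin_iff, LinearMap.isSymmetric_iff_inner_map_self_real]
  intro v
  have h1 := h v.ofLp
  have h2 : inner ℂ (M.toEuclideanLin v) v = star (star v.ofLp ⬝ᵥ M *ᵥ v.ofLp) := by
    rw [EuclideanSpace.inner_eq_star_dotProduct, ← Matrix.star_dotProduct_star, star_star]
    simp [dotProduct_comm]
  rw [h2, IsSelfAdjoint.of_nonneg h1 |>.star_eq]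
  exact IsSelfAdjoint.of_nonneg h1 |>.star_eq

lemma posSemidef_of_forall_nonneg {M : Matrix n n ℂ} (h : ∀ x, 0 ≤ star x ⬝ᵥ M *ᵥ x) :
    M.PosSemidef :=
  .of_dotProduct_mulVec_nonneg (isHermitian_of_forall_nonneg h) h

lemma trace_vecMulVec_mul (v w : n → ℂ) (M : Matrix n n ℂ) :
    (vecMulVec v w * M).trace = w ⬝ᵥ M *ᵥ v := by
  rw [vecMulVec_mul, trace_vecMulVec, dotProduct_comm, dotProduct_mulVec]

lemma PosSemidef.exists_sum_vecMulVec {M : Matrix n n ℂ} (hM : M.PosSemidef) :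
    ∃ f : n → n → ℂ, M = ∑ i, vecMulVec (f i) (star (f i)) := by
  classical
  open scoped MatrixOrder in
  obtain ⟨B, rfl⟩ := CStarAlgebra.nonneg_iff_eq_star_mul_self.mp (nonneg_iff_posSemidef.mpr hM)
  refine ⟨fun i => star (B i), ?_⟩
  ext a b
  simp [Matrix.sum_apply, vecMulVec_apply, mul_apply, star_eq_conjTranspose]

lemma PosSemidef.trace_mul_nonneg {A B : Matrix n n ℂ} (hA : A.PosSemidef) (hB : B.PosSemidef) :
    0 ≤ (A * B).trace := by
  obtain ⟨f, rfl⟩ := PosSemidef.exists_sum_vecMulVec hA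
  rw [Finset.sum_mul, trace_sum]
  exact Finset.sum_nonneg fun i _ => by
    rw [trace_vecMulVec_mul]; exact hB.dotProduct_mulVec_nonneg _

/-- A zero of the form that minimizes it along the complex line v + tr is critical, so the term
linear in t vanishes. Only this line matters: M need not be positive semidefinite, which allows use
with block-positive matrices. -/
lemma mulVec_eq_zero_of_forall_nonneg {M : Matrix n n ℂ} {v r : n → ℂ}
    (h : ∀ t : ℂ, 0 ≤ star (v + t • r) ⬝ᵥ M *ᵥ (v + t • r)) (hv : star v ⬝ᵥ M *ᵥ v = 0)
    (hr : 0 ≤ star r ⬝ᵥ M *ᵥ r) :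
    star r ⬝ᵥ M *ᵥ v = 0 := by
  set a := star r ⬝ᵥ M *ᵥ v
  set b := star v ⬝ᵥ M *ᵥ r
  set c := star r ⬝ᵥ M *ᵥ r
  have key : ∀ t : ℂ, 0 ≤ star t * a + t * b + star t * t * c := by
    intro t
    have := h t
    simp only [star_add, star_smul, mulVec_add, mulVec_smul, add_dotProduct, dotProduct_add,
      smul_dotProduct, dotProduct_smul, hv, smul_eq_mul] at this
    convert this using 1
    ring
  have lin : ∀ z : ℂ, (∀ s : ℝ, 0 ≤ (s : ℂ) * z + (s : ℂ) ^ 2 * c) → z = 0 := by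
    intro z hz
    have hc : c.im = 0 := (Complex.nonneg_iff.mp hr).2.symm
    have him : z.im = 0 := by
      have := (Complex.nonneg_iff.mp (hz 1)).2
      simp [hc] at this
      exact this.symm
    have hre : ∀ s : ℝ, 0 ≤ s * z.re + s ^ 2 * c.re := by
      intro s
      have := (Complex.nonneg_iff.mp (hz s)).1
      simpa [← Complex.ofReal_pow] using this
    have hzre : z.re = 0 := by
      have hc0 : 0 ≤ c.re := (Complex.nonneg_iff.mp hr).1
      -- Near the minimizer of the quadratic in s; the + 1 covers c = 0 and leaves a value that is
      -- minus a square.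
      have := hre (-z.re / (c.re + 1))
      have h3 : -z.re / (c.re + 1) * z.re + (-z.re / (c.re + 1)) ^ 2 * c.re =
          -(z.re ^ 2 / (c.re + 1) ^ 2) := by field_simp; ring
      rw [h3] at this
      have h4 : z.re ^ 2 / (c.re + 1) ^ 2 = 0 := le_antisymm (by linarith) (by positivity)
      rcases div_eq_zero_iff.mp h4 with h5 | h5
      · exact pow_eq_zero_iff (two_ne_zero) |>.mp h5
      · exact absurd h5 (by positivity)
    exact Complex.ext hzre him
  have h1 : a + b = 0 := lin _ fun s => by
    convert key s using 1; simp; ring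
  have h2 : -Complex.I * a + Complex.I * b = 0 := lin _ fun s => by
    convert key (s * Complex.I) using 1; simp; ring_nf; simp
  have h3 : b = a := by
    have : Complex.I * (b - a) = 0 := by linear_combination h2
    simpa [sub_eq_zero] using this
  rw [h3] at h1
  exact add_self_eq_zero.mp h1

lemma posSemidef_smul_one_add [DecidableEq n] {H : Matrix n n ℂ} (hH : H.IsHermitian) {c : ℝ}
    (hc : ∀ i, -c ≤ hH.eigenvalues i) : ((c : ℂ) • (1 : Matrix n n ℂ) + H).PosSemidef := by
  have h1 := hH.spectral_theorem
  rw [Unitary.conjStarAlgAut_apply] at h1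
  set U := hH.eigenvectorUnitary
  have h2 : (c : ℂ) • (1 : Matrix n n ℂ) + H =
      U.1 * diagonal (fun i => (c : ℂ) + hH.eigenvalues i) * star U.1 := by
    conv_lhs => rw [h1]
    rw [← diagonal_add, mul_add, add_mul]
    congr 1
    have : diagonal (fun _ : n => (c : ℂ)) = (c : ℂ) • (1 : Matrix n n ℂ) := by
      rw [smul_one_eq_diagonal]
    rw [this, Matrix.mul_smul, Matrix.mul_one, Matrix.smul_mul, Unitary.mul_star_self_of_mem U.2]
  rw [h2, star_eq_conjTranspose]
  refine PosSemidef.mul_mul_conjTranspose_same (PosSemidef.diagonal fun i => ?_) _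
  have := hc i
  change (0 : ℂ) ≤ (c : ℂ) + hH.eigenvalues i
  rw [← Complex.ofReal_add]
  exact_mod_cast by linarith

lemma PosDef.exists_add_smul_posDef {A H : Matrix n n ℂ} (hA : A.PosDef) (hH : H.IsHermitian) :
    ∃ δ : ℝ, 0 < δ ∧ ∀ s : ℝ, |s| ≤ δ → (A + (s : ℂ) • H).PosDef := by
  classical
  obtain ⟨a, ha0, ha⟩ : ∃ a : ℝ, 0 < a ∧ ∀ i, a ≤ hA.1.eigenvalues i := by
    rcases isEmpty_or_nonempty n with hn | hn
    · exact ⟨1, one_pos, fun i => hn.elim i⟩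
    · obtain ⟨i, hi⟩ := Finite.exists_min hA.1.eigenvalues
      exact ⟨_, hA.eigenvalues_pos i, hi⟩
  have bound : ∀ {K : Matrix n n ℂ} (hK : K.IsHermitian) (i : n),
      -∑ i, |hK.eigenvalues i| ≤ hK.eigenvalues i := fun hK i =>
    (neg_le_neg (Finset.single_le_sum (f := fun i => |hK.eigenvalues i|)
      (fun i _ => abs_nonneg _) (Finset.mem_univ i))).trans (neg_abs_le _)
  set b₁ := ∑ i, |hH.eigenvalues i|
  set b₂ := ∑ i, |hH.neg.eigenvalues i|
  have hb₁ : 0 ≤ b₁ := Finset.sum_nonneg fun _ _ => abs_nonneg _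
  have hb₂ : 0 ≤ b₂ := Finset.sum_nonneg fun _ _ => abs_nonneg _
  set b : ℝ := 1 + b₁ + b₂ with hb
  have hb0 : 0 < b := by rw [hb]; linarith
  have hsub : (((-a : ℝ) : ℂ) • (1 : Matrix n n ℂ) + A).PosSemidef :=
    posSemidef_smul_one_add hA.1 fun i => by simpa using ha i
  have hadd : ((b : ℂ) • (1 : Matrix n n ℂ) + H).PosSemidef :=
    posSemidef_smul_one_add hH fun i => le_trans (by linarith) (bound hH i)
  have hneg : ((b : ℂ) • (1 : Matrix n n ℂ) + -H).PosSemidef :=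
    posSemidef_smul_one_add hH.neg fun i =>
      le_trans (by linarith) (bound hH.neg i)
  -- A + sH = (a - |s|b)·1 + (A - a·1) + |s|(b·1 ± H), where the first summand is positive definite
  -- as soon as |s| ≤ a/(2b).
  refine ⟨a / (2 * b), by positivity, fun s hs => ?_⟩
  have hpos : 0 < a - |s| * b := by
    have : |s| * b ≤ a / (2 * b) * b := by gcongr
    have h2 : a / (2 * b) * b = a / 2 := by field_simp
    linarith
  have h1 : (((a - |s| * b : ℝ) : ℂ) • (1 : Matrix n n ℂ)).PosDef :=
    PosDef.one.smul (by exact_mod_cast hpos)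
  rcases abs_cases s with ⟨h, h0⟩ | ⟨h, h0⟩
  · have h2 := (h1.add_posSemidef hsub).add_posSemidef (hadd.smul (a := (s : ℂ)) (by exact_mod_cast h0))
    convert h2 using 1
    rw [h]; push_cast; module
  · have h2 := (h1.add_posSemidef hsub).add_posSemidef
      (hneg.smul (a := ((-s : ℝ) : ℂ)) (by exact_mod_cast (by linarith)))
    convert h2 using 1
    rw [h]; push_cast; module

/-- The form of the sum is ∑ |⟨v, x⟩|², which vanishes only when x is orthogonal to the span; a
basis taken from S makes the sum finite. -/
lemma exists_finset_posDef {S : Set (n → ℂ)} (hS : Submodule.span ℂ S = ⊤) :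
    ∃ F : Finset (n → ℂ), ↑F ⊆ S ∧ (∑ v ∈ F, vecMulVec v (star v)).PosDef := by
  obtain ⟨b, hbS, hspan, hli⟩ := exists_linearIndependent ℂ S
  have hfin : b.Finite := hli.setFinite
  refine ⟨hfin.toFinset, by simpa using hbS, ?_⟩
  have hform : ∀ x : n → ℂ, star x ⬝ᵥ (∑ v ∈ hfin.toFinset, vecMulVec v (star v)) *ᵥ x =
      ∑ v ∈ hfin.toFinset, star (star v ⬝ᵥ x) * (star v ⬝ᵥ x) := by
    intro x
    rw [sum_mulVec, dotProduct_sum]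
    refine Finset.sum_congr rfl fun v _ => ?_
    rw [vecMulVec_mulVec, dotProduct_smul, MulOpposite.smul_eq_mul_unop, MulOpposite.unop_op,
      ← star_dotProduct_star, star_star]
  refine .of_dotProduct_mulVec_pos
    (posSemidef_sum _ fun v _ => posSemidef_vecMulVec_self_star v).1 fun x hx => ?_
  rw [hform]
  have hnn : ∀ v ∈ hfin.toFinset, 0 ≤ star (star v ⬝ᵥ x) * (star v ⬝ᵥ x) :=
    fun v _ => star_mul_self_nonneg _
  refine lt_of_le_of_ne (Finset.sum_nonneg hnn) fun h0 => hx ?_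
  have hz := (Finset.sum_eq_zero_iff_of_nonneg hnn).mp h0.symm
  have hall : ∀ y ∈ Submodule.span ℂ b, star y ⬝ᵥ x = 0 := by
    intro y hy
    induction hy using Submodule.span_induction with
    | mem y hy =>
      have := hz y (hfin.mem_toFinset.mpr hy)
      simpa using this
    | zero => simp
    | add y z _ _ h1 h2 => simp [add_dotProduct, h1, h2]
    | smul c y _ h1 => simp [h1]
  have := hall x (by rw [hspan, hS]; trivial)
  simpa using this

end Matrices

/-! ### Choi matrices and block positivity -/

section Choi

variable {d : ℕ}

/-- The unnormalized Choi matrix `∑ |i⟩⟨j| ⊗ L(|i⟩⟨j|)`, as a linear function of `L`. -/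
def choiMatrix : MatMap d →ₗ[ℂ] BiMat d d where
  toFun L := .of fun p q => L (single p.1 q.1 1) p.2 q.2
  map_add' _ _ := rfl
  map_smul' _ _ := rfl

lemma choiMatrix_apply (L : MatMap d) (p q : Fin d × Fin d) :
    choiMatrix L p q = L (single p.1 q.1 1) p.2 q.2 := rfl

lemma choi_eq_smul (L : MatMap d) : choi L = (d : ℂ)⁻¹ • choiMatrix L := by
  ext ⟨a, b⟩ ⟨a', b'⟩
  simp only [choi, Matrix.smul_apply, Matrix.sum_apply, kroneckerMap_apply, choiMatrix_apply]
  congr 1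
  rw [Finset.sum_eq_single a, Finset.sum_eq_single a']
  · simp
  · intro j _ hj; simp [hj]
  · simp
  · intro i _ hi; simp [hi]
  · simp

lemma choiMatrix_injective : Function.Injective (choiMatrix (d := d)) := by
  intro L L' h
  refine ext_linearMap ℂ fun i j => LinearMap.ext_ring ?_
  ext a b
  exact congrFun (congrFun h (i, a)) (j, b)

lemma map_apply_eq_sum (L : MatMap d) (M : Mat d) (b b' : Fin d) :
    L M b b' = ∑ a, ∑ a', M a a' * choiMatrix L (a, b) (a', b') := by
  conv_lhs => rw [matrix_eq_sum_single M]
  simp only [map_sum, Matrix.sum_apply, choiMatrix_apply]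
  refine Finset.sum_congr rfl fun a _ => Finset.sum_congr rfl fun a' _ => ?_
  have : single a a' (M a a') = M a a' • single a a' (1 : ℂ) := by simp
  rw [this, map_smul, Matrix.smul_apply, smul_eq_mul]

/-- The vector `∑ T b a |a⟩ ⊗ |b⟩` associated with a matrix `T`. -/
def vecOf : Mat d ≃ₗ[ℂ] (Fin d × Fin d → ℂ) where
  toFun T p := T p.2 p.1
  invFun v := .of fun b a => v (a, b)
  map_add' _ _ := rfl
  map_smul' _ _ := rfl
  left_inv _ := rfl
  right_inv _ := rfl

lemma vecOf_apply (T : Mat d) (p : Fin d × Fin d) : vecOf T p = T p.2 p.1 := rfl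

/-- The Hermitian form on `M_d(ℂ)` given by the Choi matrix of `L`. -/
def choiForm (L : MatMap d) (T : Mat d) : ℂ := star (vecOf T) ⬝ᵥ choiMatrix L *ᵥ vecOf T

lemma choiForm_eq_trace (L : MatMap d) (T : Mat d) :
    choiForm L T = (vecMulVec (vecOf T) (star (vecOf T)) * choiMatrix L).trace := by
  rw [trace_vecMulVec_mul, choiForm]

lemma choiForm_add (L L' : MatMap d) (T : Mat d) :
    choiForm (L + L') T = choiForm L T + choiForm L' T := by
  simp [choiForm, add_mulVec, dotProduct_add]

lemma choiForm_eq_sum (L : MatMap d) (T : Mat d) :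
    choiForm L T = ∑ a, ∑ b, ∑ a', ∑ b',
      star (T b a) * choiMatrix L (a, b) (a', b') * T b' a' := by
  simp only [choiForm, dotProduct, mulVec, Fintype.sum_prod_type, vecOf_apply, Pi.star_apply,
    Finset.mul_sum, mul_assoc]

lemma ampliation_sum {m : ℕ} {ι : Type*} (s : Finset ι) (L : MatMap d) (f : ι → BiMat m d) :
    ampliation m L (∑ i ∈ s, f i) = ∑ i ∈ s, ampliation m L (f i) := by
  ext p q
  simp only [ampliation, of_apply, Matrix.sum_apply]
  have : (Matrix.of fun a b => ∑ c ∈ s, f c (p.1, a) (q.1, b)) =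
      ∑ c ∈ s, Matrix.of fun a b => f c (p.1, a) (q.1, b) := by
    ext a b; simp [Matrix.sum_apply]
  rw [this, map_sum, Matrix.sum_apply]

/-- The link between ampliations and the Choi form: a rank-one input and a test vector enter only
through the product B X*, which has rank at most m. -/
lemma ampliation_vecMulVec_form {m : ℕ} (L : MatMap d) (X B : Matrix (Fin d) (Fin m) ℂ) :
    (star fun p : Fin m × Fin d => B p.2 p.1) ⬝ᵥ
      ampliation m L (vecMulVec (fun p => X p.2 p.1) (star fun p => X p.2 p.1)) *ᵥ
        (fun p => B p.2 p.1) = choiForm L (B * Xᴴ) := by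
  have h1 : (star fun p : Fin m × Fin d => B p.2 p.1) ⬝ᵥ
      ampliation m L (vecMulVec (fun p => X p.2 p.1) (star fun p => X p.2 p.1)) *ᵥ
        (fun p => B p.2 p.1) = ∑ i, ∑ b, ∑ j, ∑ b', ∑ a, ∑ a',
        star (B b i) * (X a i * star (X a' j) * choiMatrix L (a, b) (a', b')) * B b' j := by
    simp only [dotProduct, mulVec, Fintype.sum_prod_type, ampliation, of_apply,
      map_apply_eq_sum L, Pi.star_apply, vecMulVec_apply, Finset.mul_sum, Finset.sum_mul, mul_assoc]
  have h2 : choiForm L (B * Xᴴ) = ∑ a, ∑ b, ∑ a', ∑ b', ∑ i, ∑ j,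
        star (B b i) * (X a i * star (X a' j) * choiMatrix L (a, b) (a', b')) * B b' j := by
    rw [choiForm_eq_sum]
    refine Finset.sum_congr rfl fun a _ => Finset.sum_congr rfl fun b _ =>
      Finset.sum_congr rfl fun a' _ => Finset.sum_congr rfl fun b' _ => ?_
    simp only [mul_apply, conjTranspose_apply, star_sum, Finset.mul_sum, Finset.sum_mul]
    rw [Finset.sum_comm]
    refine Finset.sum_congr rfl fun i _ => Finset.sum_congr rfl fun j _ => ?_
    simp only [star_mul', star_star]; ring
  rw [h1, h2]
  let G : Fin m → Fin d → Fin m → Fin d → Fin d → Fin d → ℂ := fun i b j b' a a' =>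
    star (B b i) * (X a i * star (X a' j) * choiMatrix L (a, b) (a', b')) * B b' j
  -- Both sides are the same sixfold sum in different orders, matched by permuting the index tuple.
  have h3 : ∑ x : Fin m × Fin d × Fin m × Fin d × Fin d × Fin d,
      G x.1 x.2.1 x.2.2.1 x.2.2.2.1 x.2.2.2.2.1 x.2.2.2.2.2 =
      ∑ y : Fin d × Fin d × Fin d × Fin d × Fin m × Fin m,
        G y.2.2.2.2.1 y.2.1 y.2.2.2.2.2 y.2.2.2.1 y.1 y.2.2.1 :=
    Fintype.sum_equiv
      ⟨fun x => (x.2.2.2.2.1, x.2.1, x.2.2.2.2.2, x.2.2.2.1, x.1, x.2.2.1),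
        fun y => (y.2.2.2.2.1, y.2.1, y.2.2.2.2.2, y.2.2.2.1, y.1, y.2.2.1),
        fun _ => rfl, fun _ => rfl⟩ _ _ fun _ => rfl
  simpa only [Fintype.sum_prod_type, G] using h3

/-- A positive semidefinite input is a sum of rank-one ones, so these suffice. The matrices B X* are
exactly those of rank at most m. -/
lemma isKPositive_iff {m : ℕ} (L : MatMap d) :
    IsKPositive m L ↔ ∀ B X : Matrix (Fin d) (Fin m) ℂ, 0 ≤ choiForm L (B * Xᴴ) := by
  constructor
  · intro h B X
    rw [← ampliation_vecMulVec_form]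
    exact (h _ (posSemidef_vecMulVec_self_star _)).dotProduct_mulVec_nonneg _
  · intro h X hX
    obtain ⟨f, rfl⟩ := PosSemidef.exists_sum_vecMulVec hX
    refine posSemidef_of_forall_nonneg fun w => ?_
    rw [ampliation_sum, sum_mulVec, dotProduct_sum]
    refine Finset.sum_nonneg fun i _ => ?_
    have := h (.of fun b j => w (j, b)) (.of fun b j => f i (j, b))
    rwa [← ampliation_vecMulVec_form] at this

lemma IsKPositive.choiForm_nonneg {m n : ℕ} {L : MatMap d} (h : IsKPositive m L) (hn : n ≤ m)
    (B X : Matrix (Fin d) (Fin n) ℂ) : 0 ≤ choiForm L (B * Xᴴ) := by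
  -- Padding B and X with zero columns leaves B X* unchanged, since E E* = 1.
  set E : Matrix (Fin n) (Fin m) ℂ := (1 : Matrix (Fin m) (Fin m) ℂ).submatrix (Fin.castLE hn) id
  have hE : E * Eᴴ = 1 := by
    rw [conjTranspose_submatrix, conjTranspose_one, ← submatrix_mul _ _ _ _ _ Function.bijective_id,
      Matrix.mul_one]
    exact submatrix_one _ (Fin.castLE_injective hn)
  have h1 := (isKPositive_iff L).mp h (B * E) (X * E)
  rwa [conjTranspose_mul, Matrix.mul_assoc, ← Matrix.mul_assoc E, hE, Matrix.one_mul] at h1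

lemma IsKPositive.choiForm_vecMulVec_nonneg {m : ℕ} {L : MatMap d} (h : IsKPositive m L)
    (hm : 1 ≤ m) (b c : Fin d → ℂ) : 0 ≤ choiForm L (vecMulVec b c) := by
  have := h.choiForm_nonneg hm (replicateCol (Fin 1) b) (replicateCol (Fin 1) (star c))
  convert this using 2
  ext i j
  simp [vecMulVec_apply, mul_apply]

lemma IsKPositive.choiForm_vecMulVec_add_nonneg {m : ℕ} {L : MatMap d} (h : IsKPositive m L)
    (hm : 2 ≤ m) (b c b' c' : Fin d → ℂ) :
    0 ≤ choiForm L (vecMulVec b c + vecMulVec b' c') := by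
  have := h.choiForm_nonneg hm (.of fun i => ![b i, b' i]) (.of fun i => ![star c i, star c' i])
  convert this using 2
  ext i j
  simp [vecMulVec_apply, mul_apply]

/-- A product vector plus a multiple of a product basis vector has Schmidt rank at most 2, so
2-positivity gives nonnegativity along each such line, and every coordinate of the image vanishes by
criticality. -/
lemma choiMatrix_mulVec_eq_zero {m : ℕ} {L : MatMap d} (h : IsKPositive m L) (hm : 2 ≤ m)
    (b c : Fin d → ℂ) (h0 : choiForm L (vecMulVec b c) = 0) :
    choiMatrix L *ᵥ vecOf (vecMulVec b c) = 0 := by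
  ext ⟨x, y⟩
  have key := mulVec_eq_zero_of_forall_nonneg (M := choiMatrix L) (v := vecOf (vecMulVec b c))
    (r := vecOf (vecMulVec (Pi.single y 1) (Pi.single x 1))) (fun t => ?_) h0
    (h.choiForm_vecMulVec_nonneg (by lia) _ _)
  · rw [Pi.zero_apply, ← key]
    have : star (vecOf (vecMulVec (Pi.single y (1 : ℂ)) (Pi.single x 1))) = Pi.single (x, y) 1 := by
      ext ⟨p, q⟩
      by_cases h1 : p = x <;> by_cases h2 : q = y <;>
        simp [vecOf_apply, vecMulVec_apply, h1, h2]
    rw [this, single_one_dotProduct]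
  · have := h.choiForm_vecMulVec_add_nonneg hm b c (t • Pi.single y 1) (Pi.single x 1)
    rw [smul_vecMulVec] at this
    simpa only [choiForm, map_add, map_smul] using this

/-! ### Partial transposition -/

lemma partialTranspose_apply (ρ : BiMat d d) (p q : Fin d × Fin d) :
    partialTranspose ρ p q = ρ (p.1, q.2) (q.1, p.2) := rfl

lemma partialTranspose_partialTranspose (ρ : BiMat d d) :
    partialTranspose (partialTranspose ρ) = ρ := rfl

lemma partialTranspose_smul (c : ℂ) (ρ : BiMat d d) :
    partialTranspose (c • ρ) = c • partialTranspose ρ := rfl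

lemma partialTranspose_sum {ι : Type*} (s : Finset ι) (f : ι → BiMat d d) :
    partialTranspose (∑ i ∈ s, f i) = ∑ i ∈ s, partialTranspose (f i) :=
  ampliation_sum s _ f

lemma isHermitian_partialTranspose {ρ : BiMat d d} (h : ρ.IsHermitian) :
    (partialTranspose ρ).IsHermitian := by
  ext p q
  exact h.apply _ _

/-- On product vectors, partial transposition conjugates the second factor. -/
lemma partialTranspose_vecMulVec (x y : Fin d → ℂ) :
    partialTranspose (vecMulVec (vecOf (vecMulVec y x)) (star (vecOf (vecMulVec y x)))) =
      vecMulVec (vecOf (vecMulVec (star y) x)) (star (vecOf (vecMulVec (star y) x))) := by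
  ext p q
  simp [partialTranspose_apply, vecMulVec_apply, vecOf_apply]; ring

lemma choiMatrix_transposeMap_comp (L : MatMap d) :
    choiMatrix (transposeMap d ∘ₗ L) = partialTranspose (choiMatrix L) := rfl

lemma trace_partialTranspose_mul (ρ σ : BiMat d d) :
    (partialTranspose ρ * partialTranspose σ).trace = (ρ * σ).trace := by
  simp only [trace, diag_apply, mul_apply, partialTranspose_apply, Fintype.sum_prod_type]
  refine Finset.sum_congr rfl fun a _ => ?_
  rw [Finset.sum_comm]
  rw [Finset.sum_congr rfl fun _ _ => Finset.sum_comm]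
  exact Finset.sum_comm

lemma choiForm_transposeMap_comp (L : MatMap d) (y x : Fin d → ℂ) :
    choiForm (transposeMap d ∘ₗ L) (vecMulVec y x) = choiForm L (vecMulVec (star y) x) := by
  rw [choiForm_eq_trace, choiForm_eq_trace, choiMatrix_transposeMap_comp,
    ← partialTranspose_vecMulVec, ← trace_partialTranspose_mul, partialTranspose_partialTranspose]

lemma IsCP.posSemidef_choiMatrix {L : MatMap d} (hd : 1 ≤ d) (h : IsCP L) :
    (choiMatrix L).PosSemidef := by
  refine posSemidef_of_forall_nonneg fun x => ?_
  have := (h d hd).choiForm_nonneg le_rfl (vecOf.symm x) 1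
  simpa [choiForm] using this

lemma IsDecomposable.trace_mul_nonneg {L : MatMap d} (hd : 1 ≤ d) (h : IsDecomposable L)
    {ρ : BiMat d d} (h1 : ρ.PosSemidef) (h2 : (partialTranspose ρ).PosSemidef) :
    0 ≤ (ρ * choiMatrix L).trace := by
  obtain ⟨L₁, L₂, hL₁, hL₂, rfl⟩ := h
  rw [map_add, mul_add, trace_add, ← trace_partialTranspose_mul ρ (choiMatrix L₂)]
  exact add_nonneg (PosSemidef.trace_mul_nonneg h1 (hL₁.posSemidef_choiMatrix hd))
    (PosSemidef.trace_mul_nonneg h2 (IsCP.posSemidef_choiMatrix hd hL₂))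

end Choi

/-! ### A trace inequality -/

section TraceInequality

variable {n : Type*} [Fintype n]

lemma trace_conjTranspose_mul_self_eq (K : Matrix n n ℂ) :
    (Kᴴ * K).trace = ((∑ i, ∑ j, ‖K j i‖ ^ 2 : ℝ) : ℂ) := by
  simp only [trace, diag_apply, mul_apply, conjTranspose_apply, Complex.ofReal_sum]
  refine Finset.sum_congr rfl fun i _ => Finset.sum_congr rfl fun j _ => ?_
  rw [Complex.star_def, ← Complex.normSq_eq_conj_mul_self, Complex.normSq_eq_norm_sq]

lemma sum_norm_sq_row_of_mem_unitaryGroup [DecidableEq n] {G : Matrix n n ℂ}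
    (hG : G ∈ unitaryGroup n ℂ) (i : n) : ∑ a, ‖G i a‖ ^ 2 = 1 := by
  have h := congrFun (congrFun (mem_unitaryGroup_iff.mp hG) i) i
  rw [star_eq_conjTranspose, mul_apply, one_apply_eq] at h
  have h2 : ((∑ a, ‖G i a‖ ^ 2 : ℝ) : ℂ) = 1 := by
    rw [← h, Complex.ofReal_sum]
    refine Finset.sum_congr rfl fun a _ => ?_
    rw [conjTranspose_apply, Complex.star_def, Complex.mul_conj, Complex.normSq_eq_norm_sq]
  exact_mod_cast h2

/-- In an eigenbasis U of K*K only rank(K) columns of KU are nonzero. Cauchy–Schwarz over these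
columns pairs them with as many unit rows of the unitary U*V. -/
theorem norm_trace_mul_sq_le [DecidableEq n] {V : Matrix n n ℂ} (hV : V ∈ unitaryGroup n ℂ)
    (K : Matrix n n ℂ) :
    ‖(V * K).trace‖ ^ 2 ≤ K.rank * ∑ i, ∑ j, ‖K j i‖ ^ 2 := by
  have hH : (Kᴴ * K).IsHermitian := isHermitian_conjTranspose_mul_self K
  set U := hH.eigenvectorUnitary
  set W := K * U.1
  set G := star U.1 * V
  have hG : G ∈ unitaryGroup n ℂ := mul_mem (Unitary.star_mem U.2) hV
  have hWW : Wᴴ * W = diagonal fun i => (hH.eigenvalues i : ℂ) := by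
    have := hH.conjStarAlgAut_star_eigenvectorUnitary
    rw [Unitary.conjStarAlgAut_apply] at this
    simp only [W, conjTranspose_mul]
    simpa [Matrix.mul_assoc, star_eq_conjTranspose, Function.comp_def] using this
  have hcol : ∀ i, ∑ a, ‖W a i‖ ^ 2 = hH.eigenvalues i := by
    intro i
    have h := congrFun (congrFun hWW i) i
    rw [mul_apply, diagonal_apply_eq] at h
    have h2 : ((∑ a, ‖W a i‖ ^ 2 : ℝ) : ℂ) = hH.eigenvalues i := by
      rw [← h, Complex.ofReal_sum]
      refine Finset.sum_congr rfl fun a _ => ?_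
      rw [conjTranspose_apply, Complex.star_def, ← Complex.normSq_eq_conj_mul_self,
        Complex.normSq_eq_norm_sq]
    exact_mod_cast h2
  have htr : (V * K).trace = ∑ i, ∑ a, G i a * W a i := by
    have : (G * W).trace = (V * K).trace := by
      rw [trace_mul_comm]
      simp only [G, W]
      rw [Matrix.mul_assoc K, ← Matrix.mul_assoc U.1, Unitary.mul_star_self_of_mem U.2,
        Matrix.one_mul, trace_mul_comm]
    rw [← this]; rfl
  set s : Finset n := Finset.univ.filter fun i => hH.eigenvalues i ≠ 0
  have hs : (s.card : ℝ) = K.rank := by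
    rw [← rank_conjTranspose_mul_self, hH.rank_eq_card_non_zero_eigs, Fintype.card_subtype]
  have htr' : (V * K).trace = ∑ p ∈ s ×ˢ Finset.univ, G p.1 p.2 * W p.2 p.1 := by
    rw [htr, Finset.sum_product]
    refine (Finset.sum_subset (Finset.subset_univ s) fun i _ hi => ?_).symm
    have h0 : hH.eigenvalues i = 0 := by simpa [s] using hi
    have h1 := hcol i
    rw [h0, Finset.sum_eq_zero_iff_of_nonneg fun _ _ => by positivity] at h1
    refine Finset.sum_eq_zero fun a ha => ?_
    have := h1 a ha
    rw [show W a i = 0 by simpa using this, mul_zero]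
  have hsumK : ∑ i, ∑ j, ‖K j i‖ ^ 2 = ∑ i, hH.eigenvalues i := by
    have := trace_conjTranspose_mul_self_eq K
    rw [hH.trace_eq_sum_eigenvalues] at this
    exact Complex.ofReal_injective (this.symm.trans (by simp))
  calc ‖(V * K).trace‖ ^ 2
      ≤ (∑ p ∈ s ×ˢ Finset.univ, ‖G p.1 p.2‖ * ‖W p.2 p.1‖) ^ 2 := by
        rw [htr']
        gcongr
        exact (norm_sum_le _ _).trans_eq (Finset.sum_congr rfl fun _ _ => norm_mul _ _)
    _ ≤ (∑ p ∈ s ×ˢ Finset.univ, ‖G p.1 p.2‖ ^ 2) * ∑ p ∈ s ×ˢ Finset.univ, ‖W p.2 p.1‖ ^ 2 :=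
        Finset.sum_mul_sq_le_sq_mul_sq _ _ _
    _ ≤ K.rank * ∑ i, ∑ j, ‖K j i‖ ^ 2 := by
        rw [Finset.sum_product, Finset.sum_product, hsumK]
        simp only [hcol, sum_norm_sq_row_of_mem_unitaryGroup hG, Finset.sum_const, nsmul_eq_mul,
          mul_one, hs]
        gcongr
        · exact fun i _ _ => (posSemidef_conjTranspose_mul_self K).eigenvalues_nonneg i
        · exact Finset.subset_univ s

end TraceInequality

/-! ### The form of the Breuer–Hall map -/

section Form

variable {d k : ℕ} {V : Mat d}

lemma choiMatrix_breuerHallMap_apply (k : ℕ) (V : Mat d) (a b a' b' : Fin d) :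
    choiMatrix (breuerHallMap k V) (a, b) (a', b') = ((k : ℂ) * d - k - 1)⁻¹ *
      ((k : ℂ) * (1 : Mat d) a a' * (1 : Mat d) b b' - (1 : Mat d) a b * (1 : Mat d) a' b'
        - k * (V b a' * star (V b' a))) := by
  simp only [choiMatrix_apply, breuerHallMap, LinearMap.coe_mk, AddHom.coe_mk, Matrix.smul_apply,
    Matrix.sub_apply, smul_eq_mul]
  congr 3
  · congr 1
    by_cases h : a = a'
    · subst h; simp
    · simp [h, one_apply_ne h]
  · simp [single_apply, one_apply, ← ite_and, and_comm]
  · rw [transpose_single, Matrix.mul_assoc]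
    simp [mul_apply, single_apply, ite_and]

lemma choiForm_breuerHallMap (k : ℕ) (V T : Mat d) :
    choiForm (breuerHallMap k V) T = ((k : ℂ) * d - k - 1)⁻¹ *
      (k * (Tᴴ * T).trace - star T.trace * T.trace
        - k * ((Vᴴ * T)ᵀᴴ * (Vᴴ * T)).trace) := by
  have h1 : (Tᴴ * T).trace = ∑ a, ∑ b, ∑ a', ∑ b',
      star (T b a) * ((1 : Mat d) a a' * (1 : Mat d) b b') * T b' a' := by
    simp [trace, mul_apply, one_apply]
  have h2 : star T.trace * T.trace = ∑ a, ∑ b, ∑ a', ∑ b',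
      star (T b a) * ((1 : Mat d) a b * (1 : Mat d) a' b') * T b' a' := by
    simp [trace, one_apply, Finset.sum_mul, Finset.mul_sum]
    exact Finset.sum_comm
  have h3 : ((Vᴴ * T)ᵀᴴ * (Vᴴ * T)).trace = ∑ a, ∑ b, ∑ a', ∑ b',
      star (T b a) * (V b a' * star (V b' a)) * T b' a' := by
    simp only [trace, diag_apply, mul_apply, conjTranspose_apply, transpose_apply, star_sum,
      star_mul', star_star, Finset.sum_mul, Finset.mul_sum]
    rw [Finset.sum_comm]
    refine Finset.sum_congr rfl fun a _ => ?_
    rw [Finset.sum_congr rfl fun _ _ => Finset.sum_comm, Finset.sum_comm]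
    refine Finset.sum_congr rfl fun b _ => Finset.sum_congr rfl fun a' _ =>
      Finset.sum_congr rfl fun b' _ => ?_
    ring
  rw [choiForm_eq_sum, h1, h2, h3]
  simp only [choiMatrix_breuerHallMap_apply, Finset.mul_sum, ← Finset.sum_sub_distrib]
  refine Finset.sum_congr rfl fun a _ => Finset.sum_congr rfl fun b _ =>
    Finset.sum_congr rfl fun a' _ => Finset.sum_congr rfl fun b' _ => ?_
  ring

lemma normalization_pos (hk : 1 ≤ k) (hd : 4 ≤ d) : (0 : ℂ) < ((k : ℂ) * d - k - 1)⁻¹ := by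
  have h : (0 : ℝ) < ((k : ℝ) * d - k - 1)⁻¹ := by
    have h1 : (1 : ℝ) ≤ k := by exact_mod_cast hk
    have h2 : (4 : ℝ) ≤ d := by exact_mod_cast hd
    have : (0 : ℝ) < (k : ℝ) * d - k - 1 := by nlinarith
    positivity
  have h2 : (((k : ℂ) * d - k - 1)⁻¹) = (((k : ℝ) * d - k - 1)⁻¹ : ℝ) := by push_cast; rfl
  rw [h2]
  exact_mod_cast h

/-- Skewness of V doubles the trace, Tr(V(N - Nᵀ)) = 2 Tr T, while antisymmetrizing at most doubles
the rank; the trace inequality for N - Nᵀ is then exactly what the form requires. -/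
theorem isKPositive_breuerHallMap (hk : 1 ≤ k) (hd : 4 ≤ d) (hV : V ∈ unitaryGroup (Fin d) ℂ)
    (hskew : Vᵀ = -V) : IsKPositive k (breuerHallMap k V) := by
  rw [isKPositive_iff]
  intro B X
  rw [choiForm_breuerHallMap]
  refine mul_nonneg (normalization_pos hk hd).le ?_
  set T := B * Xᴴ with hT
  set N := Vᴴ * T with hN
  have hVV : V * Vᴴ = 1 := mem_unitaryGroup_iff.mp hV
  have hVN : V * N = T := by rw [hN, ← Matrix.mul_assoc, hVV, Matrix.one_mul]
  have hNN : (Nᴴ * N).trace = (Tᴴ * T).trace := by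
    rw [hN, conjTranspose_mul, conjTranspose_conjTranspose, Matrix.mul_assoc, ← hN, hVN]
  have hVNt : (V * Nᵀ).trace = -T.trace := by
    rw [← trace_transpose, transpose_mul, transpose_transpose, hskew, Matrix.mul_neg, trace_neg,
      trace_mul_comm, hVN]
  have htr : (V * (N - Nᵀ)).trace = 2 * T.trace := by
    rw [Matrix.mul_sub, trace_sub, hVNt, hVN]; ring
  have hKK : ((N - Nᵀ)ᴴ * (N - Nᵀ)).trace = 2 * (Tᴴ * T).trace - 2 * (Nᵀᴴ * N).trace := by
    have e1 : (Nᵀᴴ * Nᵀ).trace = (Tᴴ * T).trace := by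
      rw [← hNN, ← trace_transpose (Nᴴ * N), transpose_mul Nᴴ N, trace_mul_comm]; rfl
    have e2 : (Nᴴ * Nᵀ).trace = (Nᵀᴴ * N).trace := by
      rw [← trace_transpose, transpose_mul Nᴴ, transpose_transpose, trace_mul_comm]; rfl
    rw [conjTranspose_sub, Matrix.sub_mul, Matrix.mul_sub, Matrix.mul_sub, trace_sub, trace_sub,
      trace_sub, e1, e2, hNN]
    ring
  have hrank : (N - Nᵀ).rank ≤ 2 * k := by
    have h : N = Vᴴ * B * Xᴴ := by rw [hN, hT, Matrix.mul_assoc]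
    have : N - Nᵀ = fromCols (Vᴴ * B) Xᴴᵀ * fromRows Xᴴ (-(Vᴴ * B)ᵀ) := by
      rw [fromCols_mul_fromRows, Matrix.mul_neg, ← transpose_mul, ← h, sub_eq_add_neg]
    rw [this]
    refine (rank_mul_le_left _ _).trans ((rank_le_card_width _).trans ?_)
    simp [two_mul]
  have h1 := norm_trace_mul_sq_le hV (N - Nᵀ)
  rw [htr] at h1
  have h2 := trace_conjTranspose_mul_self_eq (N - Nᵀ)
  rw [hKK] at h2
  set S := ∑ i, ∑ j, ‖(N - Nᵀ) j i‖ ^ 2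
  have hS : 0 ≤ S := Finset.sum_nonneg fun _ _ => Finset.sum_nonneg fun _ _ => by positivity
  have h3 : ‖T.trace‖ ^ 2 ≤ k * S / 2 := by
    have h4 : ((N - Nᵀ).rank : ℝ) * S ≤ (2 * k) * S := by
      gcongr; exact_mod_cast hrank
    rw [norm_mul, mul_pow] at h1
    norm_num at h1
    linarith
  have h5 : star T.trace * T.trace = ((‖T.trace‖ ^ 2 : ℝ) : ℂ) := by
    rw [Complex.star_def, ← Complex.normSq_eq_conj_mul_self, Complex.normSq_eq_norm_sq]
  have h6 : (k : ℂ) * (Tᴴ * T).trace - star T.trace * T.trace - k * (Nᵀᴴ * N).trace =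
      ((k * S / 2 - ‖T.trace‖ ^ 2 : ℝ) : ℂ) := by
    rw [h5]; push_cast; rw [← h2]; ring
  rw [h6]
  exact_mod_cast sub_nonneg.mpr h3

lemma choiForm_breuerHallMap_vecMulVec (k : ℕ) (hV : V ∈ unitaryGroup (Fin d) ℂ)
    (hskew : Vᵀ = -V) (x : Fin d → ℂ) :
    choiForm (breuerHallMap k V) (vecMulVec (V *ᵥ x) x) = 0 := by
  have hVV : Vᴴ * V = 1 := mem_unitaryGroup_iff'.mp hV
  have hVV' : V * Vᴴ = 1 := mem_unitaryGroup_iff.mp hV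
  have hN : Vᴴ * vecMulVec (V *ᵥ x) x = vecMulVec x x := by
    rw [mul_vecMulVec, mulVec_mulVec, hVV, one_mulVec]
  have htr : (vecMulVec (V *ᵥ x) x).trace = 0 := by
    have : V *ᵥ x ⬝ᵥ x = -(V *ᵥ x ⬝ᵥ x) := by
      conv_lhs => rw [dotProduct_comm, dotProduct_mulVec, ← mulVec_transpose, hskew, neg_mulVec,
        neg_dotProduct]
    rw [trace_vecMulVec]
    exact self_eq_neg.mp this
  have hT : ((vecMulVec (V *ᵥ x) x)ᴴ * vecMulVec (V *ᵥ x) x) =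
      (vecMulVec x x)ᵀᴴ * vecMulVec x x := by
    have h1 : (vecMulVec x x)ᵀ = vecMulVec x x := transpose_vecMulVec x x
    rw [h1, ← hN, conjTranspose_mul, conjTranspose_conjTranspose, Matrix.mul_assoc,
      ← Matrix.mul_assoc V, hVV', Matrix.one_mul]
  rw [choiForm_breuerHallMap, hN, htr, hT]
  simp

end Form

/-! ### Orthonormal isotropic families -/

section Isotropic

variable {d k n : ℕ} {V : Mat d}

/-- Orthonormal families that are isotropic for the alternating bilinear form `Vᴴ`. -/
structure IsIsotropic (V : Mat d) {n : ℕ} (x : Fin n → Fin d → ℂ) : Prop where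
  orthonormal : ∀ i j, star (x i) ⬝ᵥ x j = if i = j then 1 else 0
  isotropic : ∀ i j, x i ⬝ᵥ Vᴴ *ᵥ x j = 0

lemma IsIsotropic.comp {x : Fin n → Fin d → ℂ} (hx : IsIsotropic V x) {f : Fin k → Fin n}
    (hf : Function.Injective f) : IsIsotropic V (x ∘ f) where
  orthonormal i j := by simp [hx.orthonormal, hf.eq_iff]
  isotropic i j := hx.isotropic _ _

lemma conjTranspose_skew (hskew : Vᵀ = -V) : Vᴴᵀ = -Vᴴ := by
  rw [← conjTranspose_neg, ← hskew]; rfl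

lemma dotProduct_conjTranspose_mulVec_comm (hskew : Vᵀ = -V) (x y : Fin d → ℂ) :
    x ⬝ᵥ Vᴴ *ᵥ y = -(y ⬝ᵥ Vᴴ *ᵥ x) := by
  rw [dotProduct_mulVec, ← mulVec_transpose, conjTranspose_skew hskew, neg_mulVec, neg_dotProduct,
    dotProduct_comm]

lemma dotProduct_conjTranspose_mulVec_self (hskew : Vᵀ = -V) (x : Fin d → ℂ) :
    x ⬝ᵥ Vᴴ *ᵥ x = 0 :=
  self_eq_neg.mp (dotProduct_conjTranspose_mulVec_comm hskew x x)

lemma exists_smul_unit {y : Fin d → ℂ} (hy : y ≠ 0) :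
    ∃ c : ℂ, c ≠ 0 ∧ star (c • y) ⬝ᵥ (c • y) = 1 := by
  have h0 : 0 < star y ⬝ᵥ y := dotProduct_star_self_pos_iff.mpr hy
  obtain ⟨hre, him⟩ := Complex.pos_iff.mp h0
  set r := (star y ⬝ᵥ y).re
  have hr : star y ⬝ᵥ y = (r : ℂ) := Complex.ext rfl (by simpa using him.symm)
  refine ⟨((Real.sqrt r)⁻¹ : ℝ), ?_, ?_⟩
  · have := Real.sqrt_pos.mpr hre
    exact_mod_cast (inv_pos.mpr this).ne'
  · rw [star_smul, smul_dotProduct, dotProduct_smul, hr, Complex.star_def, Complex.conj_ofReal,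
      smul_eq_mul, smul_eq_mul]
    have : (Real.sqrt r)⁻¹ * ((Real.sqrt r)⁻¹ * r) = 1 := by
      rw [← mul_assoc, ← mul_inv, Real.mul_self_sqrt hre.le, inv_mul_cancel₀ hre.ne']
    exact_mod_cast this

/-- The new vector solves 2n linear equations in d > 2n unknowns; it is isotropic to itself because
V* is skew. -/
lemma IsIsotropic.exists_cons (hskew : Vᵀ = -V) {x : Fin n → Fin d → ℂ} (hx : IsIsotropic V x)
    (hn : 2 * n < d) : ∃ y, IsIsotropic V (Fin.cons y x : Fin (n + 1) → Fin d → ℂ) := by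
  let A : Matrix (Fin n ⊕ Fin n) (Fin d) ℂ :=
    fromRows (.of fun i => star (x i)) ((Matrix.of x : Matrix (Fin n) (Fin d) ℂ) * Vᴴ)
  have hker : LinearMap.ker A.mulVecLin ≠ ⊥ := LinearMap.ker_ne_bot_of_finrank_lt (by
    simp; lia)
  obtain ⟨y, hy, hy0⟩ := Submodule.exists_mem_ne_zero_of_ne_bot hker
  obtain ⟨c, -, hc⟩ := exists_smul_unit hy0
  have hA : A *ᵥ y = 0 := hy
  rw [fromRows_mulVec] at hA
  have h1 : ∀ i, star (x i) ⬝ᵥ y = 0 := fun i => congrFun hA (.inl i)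
  have h2 : ∀ i, x i ⬝ᵥ Vᴴ *ᵥ y = 0 := fun i => by
    have := congrFun hA (.inr i)
    rw [Sum.elim_inr, ← mulVec_mulVec] at this
    exact this
  refine ⟨c • y, ?_, ?_⟩
  · intro i j
    refine Fin.cases ?_ (fun i => ?_) i <;> refine Fin.cases ?_ (fun j => ?_) j
    · simpa using hc
    · have h3 : star y ⬝ᵥ x j = 0 := by
        rw [← star_star (x j), star_dotProduct_star, h1, star_zero]
      simp [h3, (Fin.succ_ne_zero j).symm]
    · simp [h1 i]
    · simp [hx.orthonormal]
  · intro i j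
    refine Fin.cases ?_ (fun i => ?_) i <;> refine Fin.cases ?_ (fun j => ?_) j
    · simp [mulVec_smul, dotProduct_conjTranspose_mulVec_self hskew]
    · have h3 : y ⬝ᵥ Vᴴ *ᵥ x j = 0 := by
        rw [dotProduct_conjTranspose_mulVec_comm hskew, h2, neg_zero]
      simp [h3]
    · simp [mulVec_smul, h2 i]
    · simp [hx.isotropic]

lemma exists_isIsotropic (hskew : Vᵀ = -V) {u : Fin d → ℂ} (hu : star u ⬝ᵥ u = 1)
    (hn : 2 * (n + 1) ≤ d) :
    ∃ x : Fin (n + 1) → Fin d → ℂ, IsIsotropic V x ∧ ∃ i, x i = u := by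
  induction n with
  | zero =>
    refine ⟨fun _ => u, ⟨fun i j => ?_, fun _ _ => dotProduct_conjTranspose_mulVec_self hskew u⟩,
      0, rfl⟩
    rw [hu, if_pos (by lia)]
  | succ n ih =>
    obtain ⟨x, hx, i, hi⟩ := ih (by lia)
    obtain ⟨y, hy⟩ := hx.exists_cons hskew (by lia)
    exact ⟨_, hy, i.succ, by simpa using hi⟩

/-- The orthogonal projection onto the span of an orthonormal family. -/
def projection (x : Fin n → Fin d → ℂ) : Mat d := ∑ i, vecMulVec (x i) (star (x i))

lemma projection_eq_mul (x : Fin n → Fin d → ℂ) :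
    projection x = (Matrix.of x)ᵀ * (Matrix.of x)ᵀᴴ := by
  ext a b
  simp [projection, Matrix.sum_apply, vecMulVec_apply, mul_apply]

lemma choiForm_breuerHallMap_projection {x : Fin n → Fin d → ℂ} (hx : IsIsotropic V x) :
    choiForm (breuerHallMap k V) (projection x) =
      ((k : ℂ) * d - k - 1)⁻¹ * (k * n - n * n) := by
  set X : Matrix (Fin d) (Fin n) ℂ := (Matrix.of x)ᵀ with hX
  have h1 : Xᴴ * X = 1 := by
    ext i j
    rw [one_apply, ← hx.orthonormal]
    rfl
  have h2 : Xᵀ * (Vᴴ * X) = 0 := by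
    ext i j
    exact hx.isotropic i j
  have htr : (X * Xᴴ).trace = n := by rw [trace_mul_comm, h1]; simp
  have h3 : (X * Xᴴ)ᴴ * (X * Xᴴ) = X * Xᴴ := by
    rw [conjTranspose_mul, conjTranspose_conjTranspose, Matrix.mul_assoc, ← Matrix.mul_assoc Xᴴ, h1,
      Matrix.one_mul]
  have h4 : (Vᴴ * (X * Xᴴ))ᵀᴴ * (Vᴴ * (X * Xᴴ)) = 0 := by
    have : (Vᴴ * (X * Xᴴ))ᵀᴴ = Vᴴᵀᴴ * (Xᵀᴴ * Xᵀ) := by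
      simp only [transpose_mul, conjTranspose_mul]
      congr 2
      ext i j
      simp
    rw [this, Matrix.mul_assoc, Matrix.mul_assoc, ← Matrix.mul_assoc Vᴴ X, ← Matrix.mul_assoc Xᵀ,
      h2]
    simp
  rw [choiForm_breuerHallMap, projection_eq_mul, ← hX, h3, h4, htr]
  simp

lemma IsKPositive.choiForm_projection_nonneg {L : MatMap d} (h : IsKPositive n L)
    (x : Fin n → Fin d → ℂ) : 0 ≤ choiForm L (projection x) := by
  rw [projection_eq_mul]
  exact h.choiForm_nonneg le_rfl _ _

lemma exists_unit (hd : 0 < d) : ∃ u : Fin d → ℂ, star u ⬝ᵥ u = 1 :=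
  ⟨Pi.single ⟨0, hd⟩ 1, by simp⟩

theorem not_isKPositive_succ_breuerHallMap (hk : 1 ≤ k) (hd : 4 ≤ d) (hkd : 2 * (k + 1) ≤ d)
    (hskew : Vᵀ = -V) : ¬ IsKPositive (k + 1) (breuerHallMap k V) := by
  intro h
  obtain ⟨u, hu⟩ := exists_unit (d := d) (by lia)
  obtain ⟨x, hx, -⟩ := exists_isIsotropic (n := k) hskew hu hkd
  have h1 := h.choiForm_projection_nonneg x
  rw [choiForm_breuerHallMap_projection hx] at h1
  have h2 : (k : ℂ) * (k + 1 : ℕ) - (k + 1 : ℕ) * (k + 1 : ℕ) = -((k + 1 : ℕ) : ℂ) := by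
    push_cast; ring
  rw [h2, mul_neg, neg_nonneg] at h1
  have h3 : (0 : ℂ) < ((k + 1 : ℕ) : ℂ) := by exact_mod_cast Nat.succ_pos k
  exact absurd (mul_pos (normalization_pos hk hd) h3) (not_lt_of_ge h1)

lemma eq_top_of_forall_vecMulVec_star_mem {S : Submodule ℂ (Mat d)}
    (h : ∀ x : Fin d → ℂ, star x ⬝ᵥ x = 1 → vecMulVec x (star x) ∈ S) : S = ⊤ := by
  have hall : ∀ x : Fin d → ℂ, vecMulVec x (star x) ∈ S := by
    intro x
    by_cases hx : x = 0
    · simp [hx]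
    · obtain ⟨c, hc0, hc⟩ := exists_smul_unit hx
      have := h _ hc
      rw [star_smul, smul_vecMulVec, vecMulVec_smul, smul_smul] at this
      exact (S.smul_mem_iff (mul_ne_zero hc0 (star_ne_zero.mpr hc0))).mp this
  rw [eq_top_iff]
  intro M _
  rw [matrix_eq_sum_single M]
  refine S.sum_mem fun a _ => S.sum_mem fun b _ => ?_
  -- Polarization, written with rank-one Hermitian matrices only.
  have key : single a b (M a b) = (M a b) • (1 / 2 : ℂ) •
      (vecMulVec (Pi.single a 1 + Pi.single b 1) (star (Pi.single a 1 + Pi.single b 1))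
      + Complex.I • vecMulVec (Pi.single a 1 + Complex.I • Pi.single b 1)
          (star (Pi.single a 1 + Complex.I • Pi.single b 1))
      - (1 + Complex.I) • (vecMulVec (Pi.single a 1) (star (Pi.single a 1))
        + vecMulVec (Pi.single b 1) (star (Pi.single b 1)))) := by
    have h1 : single a b (M a b) = M a b • vecMulVec (Pi.single a 1) (Pi.single b 1) := by
      rw [← single_eq_single_vecMulVec_single]; simp
    have hs : ∀ a : Fin d, star (Pi.single a (1 : ℂ) : Fin d → ℂ) = Pi.single a 1 := by
      intro a; rw [Pi.star_single, star_one]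
    rw [h1, star_add, star_add, star_smul, hs, hs]
    simp only [add_vecMulVec, vecMulVec_add, smul_vecMulVec, vecMulVec_smul, Complex.star_def,
      Complex.conj_I]
    congr 1
    match_scalars <;> (ring_nf; try norm_num)
  rw [key]
  exact S.smul_mem _ (S.smul_mem _ (S.sub_mem (S.add_mem (hall _) (S.smul_mem _ (hall _)))
    (S.smul_mem _ (S.add_mem (hall _) (hall _)))))

/-- Any unit vector lies in an isotropic (k+1)-family with projection P. Deleting one vector leaves
a rank-k isotropic projection; the k + 1 deletions sum to kP, so P and each P - (P - xᵢxᵢ*) lie in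
the span. -/
lemma span_projection_eq_top (hk : 1 ≤ k) (hkd : 2 * (k + 1) ≤ d) (hskew : Vᵀ = -V) :
    Submodule.span ℂ {T | ∃ x : Fin k → Fin d → ℂ, IsIsotropic V x ∧ T = projection x} = ⊤ := by
  set S := Submodule.span ℂ {T | ∃ x : Fin k → Fin d → ℂ, IsIsotropic V x ∧ T = projection x}
  refine eq_top_of_forall_vecMulVec_star_mem fun u hu => ?_
  obtain ⟨x, hx, i, rfl⟩ := exists_isIsotropic (n := k) hskew hu hkd
  have h1 : ∀ i, projection x - vecMulVec (x i) (star (x i)) ∈ S := by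
    intro i
    refine Submodule.subset_span ⟨_, hx.comp (Fin.succAbove_right_injective (p := i)), ?_⟩
    rw [projection, Fin.sum_univ_succAbove _ i, add_sub_cancel_left]
    rfl
  have h2 : projection x ∈ S := by
    have h3 := S.sum_mem fun i (_ : i ∈ Finset.univ) => h1 i
    rw [Finset.sum_sub_distrib, ← projection, Finset.sum_const, Finset.card_univ, Fintype.card_fin,
      succ_nsmul, add_sub_cancel_right, ← Nat.cast_smul_eq_nsmul ℂ] at h3
    exact (S.smul_mem_iff (by exact_mod_cast (by lia))).mp h3
  have := S.sub_mem h2 (h1 i)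
  rwa [sub_sub_cancel] at this

lemma span_star_mulVec_eq_top (hV : V ∈ unitaryGroup (Fin d) ℂ) :
    Submodule.span ℂ {T : Mat d | ∃ x, T = vecMulVec (star (V *ᵥ x)) x} = ⊤ := by
  set S := Submodule.span ℂ {T : Mat d | ∃ x, T = vecMulVec (star (V *ᵥ x)) x}
  have hVV : V * Vᴴ = 1 := mem_unitaryGroup_iff.mp hV
  have hVV' : Vᴴᵀ * Vᵀ = 1 := by rw [← transpose_mul, hVV, transpose_one]
  -- The bijection M ↦ V̄ Mᵀ carries x x* to the product matrix with factors conj(Vx) and x.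
  let f : Mat d →ₗ[ℂ] Mat d :=
    (LinearMap.mulLeft ℂ Vᴴᵀ).comp (transposeMap d)
  have hf : S.comap f = ⊤ := by
    refine eq_top_of_forall_vecMulVec_star_mem fun x _ => ?_
    refine Submodule.subset_span ⟨x, ?_⟩
    change Vᴴᵀ * (vecMulVec x (star x))ᵀ = _
    rw [transpose_vecMulVec, mul_vecMulVec]
    congr 1
    ext i
    simp [mulVec, dotProduct]
  rw [eq_top_iff]
  intro M _
  have : (Vᵀ * M)ᵀ ∈ S.comap f := by rw [hf]; trivial
  have h2 : f (Vᵀ * M)ᵀ = M := by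
    change Vᴴᵀ * (Vᵀ * M)ᵀᵀ = M
    rw [transpose_transpose, ← Matrix.mul_assoc, hVV', Matrix.one_mul]
  rwa [Submodule.mem_comap, h2] at this

end Isotropic

/-! ### Optimality and indecomposability -/

section Optimality

variable {d k : ℕ} {V : Mat d}

lemma exists_finset_vecOf_posDef {Z : Set (Mat d)} (hZ : Submodule.span ℂ Z = ⊤) :
    ∃ F : Finset (Fin d × Fin d → ℂ), (∀ v ∈ F, ∃ T ∈ Z, vecOf T = v) ∧
      (∑ v ∈ F, vecMulVec v (star v)).PosDef := by
  have h : Submodule.span ℂ (vecOf '' Z) = ⊤ := by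
    have := Submodule.map_span (vecOf (d := d)).toLinearMap Z
    rw [hZ, Submodule.map_top, LinearEquiv.range] at this
    exact this.symm
  obtain ⟨F, hF, hpos⟩ := exists_finset_posDef h
  exact ⟨F, fun v hv => hF hv, hpos⟩

/-- A state of Schmidt number at most `k` on which the Breuer–Hall witness vanishes, in the
interior of the cone of positive semidefinite matrices with positive partial transpose. -/
lemma exists_interior_ppt (hk : 1 ≤ k) (hkd : 2 * (k + 1) ≤ d)
    (hV : V ∈ unitaryGroup (Fin d) ℂ) (hskew : Vᵀ = -V) :
    ∃ ρ : BiMat d d, (∀ L : MatMap d, IsKPositive k L → 0 ≤ (ρ * choiMatrix L).trace) ∧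
      (ρ * choiMatrix (breuerHallMap k V)).trace = 0 ∧
      ∀ H : BiMat d d, H.IsHermitian → ∃ ε : ℝ, 0 < ε ∧ ∀ s : ℝ, |s| ≤ ε →
        (ρ + (s : ℂ) • H).PosDef ∧ (partialTranspose (ρ + (s : ℂ) • H)).PosDef := by
  obtain ⟨F, hF, hFpos⟩ := exists_finset_vecOf_posDef (span_projection_eq_top hk hkd hskew)
  obtain ⟨F', hF', hFpos'⟩ := exists_finset_vecOf_posDef (span_star_mulVec_eq_top hV)
  set τ : BiMat d d := ∑ v ∈ F, vecMulVec v (star v)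
  set σ' : BiMat d d := ∑ v ∈ F', vecMulVec v (star v) with hσ'
  -- With ρ = σ'^Γ + δτ, where Γ is partial transposition, ρ inherits definiteness from τ and ρ^Γ =
  -- σ' + δτ^Γ from σ', provided δ is small.
  obtain ⟨δ, hδ, hδpos⟩ := PosDef.exists_add_smul_posDef hFpos'
    (isHermitian_partialTranspose hFpos.1)
  have hterm : ∀ v ∈ F', ∃ x, partialTranspose (vecMulVec v (star v)) =
      vecMulVec (vecOf (vecMulVec (V *ᵥ x) x)) (star (vecOf (vecMulVec (V *ᵥ x) x))) := by
    intro v hv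
    obtain ⟨T, ⟨x, rfl⟩, rfl⟩ := hF' v hv
    exact ⟨x, by rw [partialTranspose_vecMulVec, star_star]⟩
  have hσsum : partialTranspose σ' = ∑ v ∈ F', partialTranspose (vecMulVec v (star v)) :=
    partialTranspose_sum _ _
  have hσ : (partialTranspose σ').PosSemidef := by
    rw [hσsum]
    refine posSemidef_sum _ fun v hv => ?_
    obtain ⟨x, hx⟩ := hterm v hv
    rw [hx]
    exact posSemidef_vecMulVec_self_star _
  have hδ' : (0 : ℂ) < (δ : ℂ) := by exact_mod_cast hδ
  have htrace : ∀ L : MatMap d, ((partialTranspose σ' + (δ : ℂ) • τ) * choiMatrix L).trace =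
      ∑ v ∈ F', (partialTranspose (vecMulVec v (star v)) * choiMatrix L).trace +
        δ * ∑ v ∈ F, (vecMulVec v (star v) * choiMatrix L).trace := by
    intro L
    rw [hσsum, add_mul, smul_mul_assoc, Finset.sum_mul, Finset.sum_mul, trace_add, trace_smul,
      trace_sum, trace_sum, smul_eq_mul]
  refine ⟨partialTranspose σ' + (δ : ℂ) • τ, fun L hL => ?_, ?_, fun H hH => ?_⟩
  · rw [htrace]
    refine add_nonneg (Finset.sum_nonneg fun v hv => ?_)
      (mul_nonneg hδ'.le (Finset.sum_nonneg fun v hv => ?_))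
    · obtain ⟨x, hx⟩ := hterm v hv
      rw [hx, ← choiForm_eq_trace]
      exact hL.choiForm_vecMulVec_nonneg hk _ _
    · obtain ⟨T, ⟨x, -, rfl⟩, rfl⟩ := hF v hv
      rw [← choiForm_eq_trace]
      exact hL.choiForm_projection_nonneg x
  · rw [htrace, Finset.sum_eq_zero, Finset.sum_eq_zero, mul_zero, add_zero]
    · intro v hv
      obtain ⟨T, ⟨x, hx, rfl⟩, rfl⟩ := hF v hv
      rw [← choiForm_eq_trace, choiForm_breuerHallMap_projection hx, sub_self, mul_zero]
    · intro v hv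
      obtain ⟨x, hx⟩ := hterm v hv
      rw [hx, ← choiForm_eq_trace, choiForm_breuerHallMap_vecMulVec k hV hskew]
  · have h1 : (partialTranspose σ' + (δ : ℂ) • τ).PosDef :=
      PosDef.posSemidef_add hσ (hFpos.smul hδ')
    have h2 : (partialTranspose (partialTranspose σ' + (δ : ℂ) • τ)).PosDef :=
      hδpos δ (abs_of_pos hδ).le
    obtain ⟨ε₁, hε₁, h₁⟩ := PosDef.exists_add_smul_posDef h1 hH
    obtain ⟨ε₂, hε₂, h₂⟩ := PosDef.exists_add_smul_posDef h2 (isHermitian_partialTranspose hH)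
    exact ⟨min ε₁ ε₂, lt_min hε₁ hε₂, fun s hs =>
      ⟨h₁ s (hs.trans (min_le_left _ _)), h₂ s (hs.trans (min_le_right _ _))⟩⟩

lemma eq_zero_of_forall_isHermitian_trace {C : BiMat d d}
    (h : ∀ H : BiMat d d, H.IsHermitian → (H * C).trace = 0) : C = 0 := by
  -- The two Hermitian test matrices C + C* and i(C - C*) together isolate Tr(C*C).
  have h1 := h (C + Cᴴ) (isHermitian_add_transpose_self C)
  have h2 := h (Complex.I • (C - Cᴴ)) (by
    rw [IsHermitian, conjTranspose_smul, conjTranspose_sub, conjTranspose_conjTranspose]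
    simp [← smul_neg])
  rw [smul_mul_assoc, trace_smul, smul_eq_mul, mul_eq_zero, or_iff_right Complex.I_ne_zero,
    sub_mul, trace_sub] at h2
  rw [add_mul, trace_add] at h1
  refine trace_conjTranspose_mul_self_eq_zero_iff.mp ?_
  linear_combination (h1 - h2) / 2

lemma isHermitian_choiMatrix_breuerHallMap (hk : 1 ≤ k) (hd : 4 ≤ d) :
    (choiMatrix (breuerHallMap k V)).IsHermitian := by
  refine IsHermitian.ext fun ⟨a, b⟩ ⟨a', b'⟩ => ?_
  have h1 : ∀ i j, star ((1 : Mat d) i j) = (1 : Mat d) j i := fun i j =>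
    congrFun (congrFun conjTranspose_one j) i
  have hc : star ((k : ℂ) * d - k - 1)⁻¹ = ((k : ℂ) * d - k - 1)⁻¹ :=
    IsSelfAdjoint.of_nonneg (normalization_pos hk hd).le
  rw [choiMatrix_breuerHallMap_apply, choiMatrix_breuerHallMap_apply]
  simp only [star_mul', star_sub, hc, h1, star_star, star_natCast]
  have h2 : ∀ i j, (1 : Mat d) i j = (1 : Mat d) j i := fun i j =>
    congrFun (congrFun transpose_one j) i
  rw [h2 b a, h2 b' a']
  ring

/-- Tr(· C_L) is nonnegative on the PPT cone but nonpositive at the interior point ρ, so moving by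
±εH shows that it vanishes in every Hermitian direction. -/
theorem eq_zero_of_isDecomposable (hk : 1 ≤ k) (hkd : 2 * (k + 1) ≤ d)
    (hV : V ∈ unitaryGroup (Fin d) ℂ) (hskew : Vᵀ = -V) {L : MatMap d} (hL : IsDecomposable L)
    (hsub : IsKPositive k (breuerHallMap k V - L)) : L = 0 := by
  obtain ⟨ρ, hpos, hzero, hint⟩ := exists_interior_ppt hk hkd hV hskew
  have h1 := hpos _ hsub
  rw [map_sub, mul_sub, trace_sub, hzero, zero_sub, neg_nonneg] at h1
  refine choiMatrix_injective ((eq_zero_of_forall_isHermitian_trace fun H hH => ?_).trans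
    (map_zero _).symm)
  obtain ⟨ε, hε, h⟩ := hint H hH
  have hdec : ∀ s : ℝ, |s| ≤ ε → 0 ≤ (s : ℂ) * (H * choiMatrix L).trace := by
    intro s hs
    have h2 := hL.trace_mul_nonneg (by lia) (h s hs).1.posSemidef (h s hs).2.posSemidef
    rw [add_mul, trace_add, smul_mul_assoc, trace_smul, smul_eq_mul] at h2
    exact h2.trans (add_le_of_nonpos_left h1)
  have hε' : (0 : ℂ) < (ε : ℂ) := by exact_mod_cast hε
  have h3 := hdec ε (abs_of_pos hε).le
  have h4 := hdec (-ε) (by rw [abs_neg, abs_of_pos hε])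
  rw [Complex.ofReal_neg, neg_mul, neg_nonneg] at h4
  exact (mul_eq_zero.mp (le_antisymm h4 h3)).resolve_left hε'.ne'

/-- At the zeros (Vx)xᵀ both summands are nonnegative, so both vanish. Since k + 1 ≥ 2, the
conjugated product vectors lie in the kernel of the Choi matrix of L', and they span. -/
theorem not_isKPositive_add_transpose (hk : 1 ≤ k) (hd : 4 ≤ d) (hkd : 2 * (k + 1) ≤ d)
    (hV : V ∈ unitaryGroup (Fin d) ℂ) (hskew : Vᵀ = -V) {L L' : MatMap d}
    (hL : IsKPositive (k + 1) L) (hL' : IsKPositive (k + 1) L') :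
    breuerHallMap k V ≠ L + transposeMap d ∘ₗ L' := by
  intro heq
  have hz : ∀ x : Fin d → ℂ, choiForm L' (vecMulVec (star (V *ᵥ x)) x) = 0 := by
    intro x
    have h1 := choiForm_breuerHallMap_vecMulVec k hV hskew x
    rw [heq, choiForm_add, choiForm_transposeMap_comp] at h1
    exact ((add_eq_zero_iff_of_nonneg (hL.choiForm_vecMulVec_nonneg (by lia) _ _)
      (hL'.choiForm_vecMulVec_nonneg (by lia) _ _)).mp h1).2
  have hker : Submodule.span ℂ {T : Mat d | ∃ x, T = vecMulVec (star (V *ᵥ x)) x} ≤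
      LinearMap.ker ((choiMatrix L').mulVecLin ∘ₗ vecOf.toLinearMap) := by
    rw [Submodule.span_le]
    rintro _ ⟨x, rfl⟩
    exact choiMatrix_mulVec_eq_zero hL' (by lia) _ _ (hz x)
  rw [span_star_mulVec_eq_top hV, top_le_iff, LinearMap.ker_eq_top] at hker
  have h0 : choiMatrix L' = 0 := by
    refine ext_of_mulVec_single fun p => ?_
    have := LinearMap.congr_fun hker (vecOf.symm (Pi.single p 1))
    rw [mulVec_single_one, zero_mulVec, ← mulVec_single_one]
    simpa using this
  have h0' : L' = 0 := choiMatrix_injective (h0.trans (map_zero _).symm)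
  rw [h0', LinearMap.comp_zero, add_zero] at heq
  exact not_isKPositive_succ_breuerHallMap hk hd hkd hskew (heq ▸ hL)

theorem not_isDecomposable_breuerHallMap (hk : 1 ≤ k) (hd : 4 ≤ d) (hkd : 2 * (k + 1) ≤ d)
    (hV : V ∈ unitaryGroup (Fin d) ℂ) (hskew : Vᵀ = -V) :
    ¬ IsDecomposable (breuerHallMap k V) := by
  rintro ⟨L, L', hL, hL', heq⟩
  exact not_isKPositive_add_transpose hk hd hkd hV hskew (hL (k + 1) (by lia))
    (hL' (k + 1) (by lia)) heq

lemma neg_of_mul_neg_of_pos {c z : ℂ} (hc : 0 < c) (h : c * z < 0) : z < 0 := by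
  have := mul_neg_of_pos_of_neg (RCLike.inv_pos_of_pos hc) h
  rwa [inv_mul_cancel_left₀ hc.ne'] at this

/-- Functionals on Hermitian matrices with `f < 0 → g < 0` are positively proportional. -/
lemma exists_pos_smul_eq_of_forall_trace_neg {C C' : BiMat d d} (hC : C.IsHermitian) (hC0 : C ≠ 0)
    (h : ∀ H : BiMat d d, H.IsHermitian → (H * C).trace < 0 → (H * C').trace < 0) :
    ∃ c : ℝ, 0 < c ∧ C' = (c : ℂ) • C := by
  obtain ⟨a, ha⟩ : ∃ a : ℝ, (C * C).trace = a := ⟨_, by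
    have := trace_conjTranspose_mul_self_eq C
    rwa [hC.eq] at this⟩
  have ha0 : 0 < a := by
    have h1 : 0 ≤ (Cᴴ * C).trace := (posSemidef_conjTranspose_mul_self C).trace_nonneg
    have h2 : (Cᴴ * C).trace ≠ 0 := fun h => hC0 (trace_conjTranspose_mul_self_eq_zero_iff.mp h)
    rw [hC.eq, ha] at h1 h2
    exact lt_of_le_of_ne (by exact_mod_cast h1) (by exact_mod_cast h2.symm)
  have hneg : (-C * C).trace < 0 := by
    rw [neg_mul, trace_neg, ha, neg_lt_zero]; exact_mod_cast ha0
  have h0 := h (-C) hC.neg hneg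
  rw [neg_mul, trace_neg, neg_lt_zero] at h0
  obtain ⟨hb0, hbim⟩ := Complex.pos_iff.mp h0
  set b := (C * C').trace.re
  have hb : (C * C').trace = b := Complex.ext rfl (by simpa using hbim.symm)
  -- Adding -sC pushes H into the negative half-space; letting s tend to 0, for both H and -H, gives
  -- the vanishing.
  have hker : ∀ H : BiMat d d, H.IsHermitian → (H * C).trace = 0 → (H * C').trace = 0 := by
    have hlin : ∀ H : BiMat d d, H.IsHermitian → (H * C).trace = 0 → ∀ s : ℝ, 0 < s →
        (H * C').trace - s * b < 0 := by
      intro H hH hHC s hs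
      have := h (H + (s : ℂ) • -C) (hH.add (hC.neg.smul (by simp [IsSelfAdjoint])))  ?_
      · rwa [add_mul, trace_add, smul_mul_assoc, trace_smul, neg_mul, trace_neg, hb, smul_eq_mul,
          mul_neg, ← sub_eq_add_neg] at this
      · rw [add_mul, trace_add, hHC, zero_add, smul_mul_assoc, trace_smul, smul_eq_mul]
        exact mul_neg_of_pos_of_neg (by exact_mod_cast hs) hneg
    have hre : ∀ H : BiMat d d, H.IsHermitian → (H * C).trace = 0 → (H * C').trace.re ≤ 0 := by
      intro H hH hHC
      refine le_of_forall_pos_le_add fun s hs => ?_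
      have := (Complex.neg_iff.mp (hlin H hH hHC (s / b) (by positivity))).1
      rw [← Complex.ofReal_mul, div_mul_cancel₀ _ hb0.ne'] at this
      simp at this
      linarith
    intro H hH hHC
    have h1 := hre H hH hHC
    have h2 := hre (-H) hH.neg (by rw [neg_mul, trace_neg, hHC, neg_zero])
    have h3 := (Complex.neg_iff.mp (hlin H hH hHC 1 one_pos)).2
    rw [neg_mul, trace_neg, Complex.neg_re] at h2
    exact Complex.ext (le_antisymm h1 (by simpa using h2)) (by simpa using h3)
  refine ⟨b / a, by positivity, sub_eq_zero.mp (eq_zero_of_forall_isHermitian_trace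
    fun H hH => ?_)⟩
  obtain ⟨t, ht⟩ : ∃ t : ℝ, (H * C).trace = t := by
    refine ⟨(H * C).trace.re, (Complex.conj_eq_iff_re.mp ?_).symm⟩
    rw [← Complex.star_def, ← trace_conjTranspose, conjTranspose_mul, hH.eq, hC.eq, trace_mul_comm]
  have h1 := hker (H - ((t / a : ℝ) : ℂ) • C) (hH.sub (hC.smul (by simp [IsSelfAdjoint]))) (by
    rw [sub_mul, trace_sub, smul_mul_assoc, trace_smul, ht, ha, smul_eq_mul, ← Complex.ofReal_mul,
      div_mul_cancel₀ _ ha0.ne', sub_self])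
  rw [sub_mul, trace_sub, smul_mul_assoc, trace_smul, hb, smul_eq_mul] at h1
  rw [mul_sub, trace_sub, mul_smul_comm, trace_smul, ht, smul_eq_mul, ← h1]
  push_cast
  ring

theorem optimal_breuerHallMap (hk : 1 ≤ k) (hd : 4 ≤ d) (hkd : 2 * (k + 1) ≤ d)
    (hV : V ∈ unitaryGroup (Fin d) ℂ) (hskew : Vᵀ = -V) {L : MatMap d} (hL : IsKPositive k L)
    (hsub : detectedPPT (breuerHallMap k V) ⊆ detectedPPT L) :
    ∃ c : ℝ, 0 < c ∧ L = (c : ℂ) • breuerHallMap k V := by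
  obtain ⟨ρ, hpos, hzero, hint⟩ := exists_interior_ppt hk hkd hV hskew
  have : Nonempty (Fin d) := ⟨⟨0, by lia⟩⟩
  have hBH0 : choiMatrix (breuerHallMap k V) ≠ 0 := fun h =>
    not_isKPositive_succ_breuerHallMap hk hd hkd hskew (by
      rw [isKPositive_iff]; intro B X; simp [choiForm, h])
  suffices h : ∀ H : BiMat d d, H.IsHermitian →
      (H * choiMatrix (breuerHallMap k V)).trace < 0 → (H * choiMatrix L).trace < 0 by
    obtain ⟨c, hc, hcL⟩ := exists_pos_smul_eq_of_forall_trace_neg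
      (isHermitian_choiMatrix_breuerHallMap hk hd) hBH0 h
    exact ⟨c, hc, choiMatrix_injective (hcL.trans (map_smul _ _ _).symm)⟩
  intro H hH hneg
  obtain ⟨ε, hε, hρ⟩ := hint H hH
  obtain ⟨h1, h2⟩ := hρ ε (abs_of_pos hε).le
  have hε' : (0 : ℂ) < (ε : ℂ) := by exact_mod_cast hε
  -- The witness is zero at ρ, so the sign of its value at ω is that of Tr(HC); normalizing ω gives
  -- a detected PPT state.
  set ω := ρ + (ε : ℂ) • H
  have htr : 0 < ω.trace⁻¹ := RCLike.inv_pos_of_pos h1.trace_pos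
  have hdinv : (0 : ℂ) < (d : ℂ)⁻¹ :=
    RCLike.inv_pos_of_pos (by exact_mod_cast (by lia : 0 < d))
  have hscale : ∀ L : MatMap d, ((ω.trace⁻¹ • ω) * choi L).trace =
      ω.trace⁻¹ * (d : ℂ)⁻¹ * (ω * choiMatrix L).trace := by
    intro L
    rw [choi_eq_smul, smul_mul_assoc, mul_smul_comm, trace_smul, trace_smul, smul_eq_mul,
      smul_eq_mul, mul_assoc]
  have hωtr : ∀ L : MatMap d, (ω * choiMatrix L).trace =
      (ρ * choiMatrix L).trace + ε * (H * choiMatrix L).trace := by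
    intro L
    rw [add_mul, trace_add, smul_mul_assoc, trace_smul, smul_eq_mul]
  have hmem : ω.trace⁻¹ • ω ∈ detectedPPT (breuerHallMap k V) := by
    refine ⟨⟨h1.posSemidef.smul htr.le, ?_, ?_⟩, ?_⟩
    · rw [trace_smul, smul_eq_mul, inv_mul_cancel₀ h1.trace_pos.ne']
    · rw [partialTranspose_smul]
      exact h2.posSemidef.smul htr.le
    · rw [hscale, hωtr, hzero, zero_add]
      exact mul_neg_of_pos_of_neg (mul_pos htr hdinv) (mul_neg_of_pos_of_neg hε' hneg)
  have h3 := (hsub hmem).2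
  rw [hscale, hωtr] at h3
  have h4 := neg_of_mul_neg_of_pos (mul_pos htr hdinv) h3
  exact neg_of_mul_neg_of_pos hε' ((le_add_of_nonneg_left (hpos L hL)).trans_lt h4)

end Optimality

end BreuerHall

theorem mainTheorem4 (d k : ℕ) (hd_even : Even d) (hd : 4 ≤ d) (hk1 : 1 ≤ k) (hk2 : k ≤ d / 2 - 1)
    (V : BreuerHall.Mat d) (hV_unitary : V ∈ Matrix.unitaryGroup (Fin d) ℂ)
    (hV_skew : Vᵀ = -V) :
    BreuerHall.IsOptimalKPositiveIndecomposable k (BreuerHall.breuerHallMap k V) ∧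
    (∀ L'' : BreuerHall.MatMap d, BreuerHall.IsDecomposable L'' → L'' ≠ 0 →
      ¬ BreuerHall.IsKPositive k (BreuerHall.breuerHallMap k V - L'')) ∧
    ¬ ∃ L' L'' : BreuerHall.MatMap d,
      BreuerHall.IsKPositive (k + 1) L' ∧ BreuerHall.IsKPositive (k + 1) L'' ∧
      BreuerHall.breuerHallMap k V = L' + BreuerHall.transposeMap d ∘ₗ L'' := by
  -- Room for an isotropic family of k + 1 vectors; the truncated subtraction is harmless because d
  -- ≥ 4.
  have hkd : 2 * (k + 1) ≤ d := by lia
  refine ⟨⟨BreuerHall.isKPositive_breuerHallMap hk1 hd hV_unitary hV_skew,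
    BreuerHall.not_isKPositive_succ_breuerHallMap hk1 hd hkd hV_skew,
    BreuerHall.not_isDecomposable_breuerHallMap hk1 hd hkd hV_unitary hV_skew,
    fun L' hL' _ hsub =>
      BreuerHall.optimal_breuerHallMap hk1 hd hkd hV_unitary hV_skew hL' hsub⟩,
    fun L'' hL'' hne h => hne
      (BreuerHall.eq_zero_of_isDecomposable hk1 hkd hV_unitary hV_skew hL'' h), ?_⟩
  rintro ⟨L', L'', hL', hL'', h⟩
  exact BreuerHall.not_isKPositive_add_transpose hk1 hd hkd hV_unitary hV_skew hL' hL'' h
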